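/- **Formulas.** A $(3,3)$-CNF formula $\varphi$ has $n_v$ variables and $m=n_2+n_3$ clauses, $n_2$ of them with two literals and $n_3$ with three; every variable occurs in at most three clauses. **The graph.** A vertex cover graph $G=(V,E)$ of $\varphi$ is a graph built as follows. Every variable is replaced by a cycle of length eight, every three-literal clause by a cycle of length nine, every two-literal clause by a single edge. For every occurrence of a literal in a clause there is a wire $w$: a path with $2t_w+1$ edges ($t_w\ge 0$ an integer) and $2t_w$ new inner vertices that joins a vertex of the cycle of its variable to a vertex of the gadget of its clause. On a variable cycle the wires of positive literals are attached to vertices of one parity class and those of negative literals to vertices of the other. The two wires of a two-literal clause are attached to the two endpoints of its edge; the three wires of a three-literal clause are attached to three vertices that split its cycle into three arcs of odd length. $W$ denotes the set of wires, and $k:=4n_v+5n_3+n_2+\sum_{w\in W}t_w$. **The embedding and the clustering instance.** Let $\Pi:V\to\mathbb R^d$ and let $E=E_1\sqcup E_2$ be a partition such that $\|\Pi(u)-\Pi(v)\|=2$ for $(u,v)\in E_1$, $\|\Pi(u)-\Pi(v)\|=2\sqrt2$ for $(u,v)\in E_2$, and for every edge $(u,v)$ the midpoint $(\Pi(u)+\Pi(v))/2$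 has squared distance at least $4$ from $\Pi(x)$ for every $x\in V\setminus\{u,v\}$. The candidate centers are $\mathcal C=\Pi(V)$ and the clients are the midpoints of all edges, $P=\{(\Pi(u)+\Pi(v))/2:(u,v)\in E\}$. A solution is a set $\mathcal S\subseteq\mathcal C$ with $|\mathcal S|=k$; its cost is $\sum_{p\in P}\mathrm{dist}(p,\mathcal S)^z$, with $z=2$ for discrete $k$-means and $z=1$ for discrete $k$-median. **Lemma.** There are an absolute constant $c'>0$, a polynomial $q$ and a (multi-stack) Turing machine $M$ such that the following holds for all such $\varphi$, $G$, $d$, $\Pi$, $E_1$, $E_2$, every $\varepsilon\ge 0$ and every solution $\mathcal S$ as above. If the $k$-means cost of $\mathcal S$ is at most $(1+\varepsilon)(|E_1|+2|E_2|)$, or its $k$-median cost is at most $(1+\varepsilon)(|E_1|+\sqrt2\,|E_2|)$, then $M$, given $\varphi$, $G$ (described by its gadgets and wires) and the vertex set $\{v\in V:\Pi(v)\in\mathcal S\}$, halts within $q(|V|)$ steps and outputs an assignment of the variables that satisfies at least $m-c'\varepsilon|E|$ clauses of $\varphi$. -/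

import Mathlib

noncomputable section

namespace VCClustering

/-! ### (3,3)-CNF formulas -/

/-- A (3,3)-CNF formula with variables indexed by `Fin n` and clauses indexed by `Fin m`: every
clause has two or three literals and every variable occurs in at most three clauses. The literal
`(i, true)` is the variable `i`, the literal `(i, false)` is its negation. -/
structure CNF33 (n m : ℕ) where
  clause : Fin m → List (Fin n × Bool)
  width : ∀ j, (clause j).length = 2 ∨ (clause j).length = 3
  occurrences : ∀ i : Fin n,
    (Finset.univ.filter fun j : Fin m => ∃ b : Bool, (i, b) ∈ clause j).card ≤ 3

namespace CNF33

variable {n m : ℕ} (φ : CNF33 n m)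

/-- The assignment `α` satisfies the clause `j`. -/
def Satisfies (α : Fin n → Bool) (j : Fin m) : Prop :=
  ∃ l ∈ φ.clause j, α l.1 = l.2

/-- The number of clauses satisfied by the assignment `α`. -/
def numSatisfied (α : Fin n → Bool) : ℕ :=
  {j : Fin m | φ.Satisfies α j}.ncard

/-- The number of clauses having exactly `r` literals. -/
def numClauses (r : ℕ) : ℕ :=
  (Finset.univ.filter fun j : Fin m => (φ.clause j).length = r).card

/-- There is one wire for each occurrence of a literal: the wire `⟨j, q⟩` belongs to the literal in
position `q` of the clause `j`. -/
abbrev Wire : Type := Σ j : Fin m, Fin (φ.clause j).length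

/-- The literal that a wire belongs to. -/
def lit (w : φ.Wire) : Fin n × Bool := (φ.clause w.1).get w.2

/-- The number of vertices of a clause gadget: a cycle of length nine for a clause with three
literals, a single edge for a clause with two literals. -/
def gadgetSize (j : Fin m) : ℕ := if (φ.clause j).length = 3 then 9 else 2

end CNF33

/-! ### The vertex cover graph of a formula -/

/-- The choices left open by the construction: the lengths of the wires and the vertices of the
gadgets to which they are attached. -/
structure Layout {n m : ℕ} (φ : CNF33 n m) where
  /-- The wire `w` is a path with `2 * t w + 1` edges. -/
  t : φ.Wire → ℕ
  /-- The vertex of the variable cycle to which the wire is attached. -/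
  varPort : φ.Wire → Fin 8
  /-- Wires of positive and of negative literals are attached to the two different parity classes
  of the variable cycle. -/
  varPort_even : ∀ w, Even (varPort w).val ↔ (φ.lit w).2 = true
  /-- The vertex of the clause gadget to which the wire is attached. -/
  clausePort : (w : φ.Wire) → Fin (φ.gadgetSize w.1)
  /-- The wires of a clause are attached in order around the gadget, with an odd number of edges
  between consecutive ones. For a single edge this says that the two wires are attached to its two
  endpoints; on the cycle of length nine the third arc has odd length as well. -/
  clausePort_odd : ∀ (j : Fin m) (q q' : Fin (φ.clause j).length), q'.val = q.val + 1 →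
    ∃ r : ℕ, (clausePort ⟨j, q'⟩).val = (clausePort ⟨j, q⟩).val + (2 * r + 1)

namespace Layout

variable {n m : ℕ} {φ : CNF33 n m} (L : Layout φ)

/-- The vertices: eight for each variable, nine or two for each clause, and `2 * t w` inner
vertices for each wire `w`. -/
abbrev Vertex : Type :=
  (Fin n × Fin 8) ⊕ (Σ j : Fin m, Fin (φ.gadgetSize j)) ⊕ (Σ w : φ.Wire, Fin (2 * L.t w))

/-- The vertex `a` of the cycle of the variable `i`. -/
def varV (i : Fin n) (a : Fin 8) : L.Vertex := Sum.inl (i, a)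

/-- The vertex `a` of the gadget of the clause `j`. -/
def clauseV (j : Fin m) (a : Fin (φ.gadgetSize j)) : L.Vertex := Sum.inr (Sum.inl ⟨j, a⟩)

/-- The inner vertex number `s` of the wire `w`, counted from the variable to the clause. -/
def wireV (w : φ.Wire) (s : Fin (2 * L.t w)) : L.Vertex := Sum.inr (Sum.inr ⟨w, s⟩)

/-- The edges of the graph, each with one orientation (or both). -/
inductive Link : L.Vertex → L.Vertex → Prop
  | varCycle (i : Fin n) (a : Fin 8) : Link (L.varV i a) (L.varV i (a + 1))
  | clauseGadget (j : Fin m) (a b : Fin (φ.gadgetSize j))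
      (h : b.val = (a.val + 1) % φ.gadgetSize j) : Link (L.clauseV j a) (L.clauseV j b)
  | wirePath (w : φ.Wire) (s s' : Fin (2 * L.t w)) (h : s'.val = s.val + 1) :
      Link (L.wireV w s) (L.wireV w s')
  | wireStart (w : φ.Wire) (s : Fin (2 * L.t w)) (h : s.val = 0) :
      Link (L.varV (φ.lit w).1 (L.varPort w)) (L.wireV w s)
  | wireEnd (w : φ.Wire) (s : Fin (2 * L.t w)) (h : s.val + 1 = 2 * L.t w) :
      Link (L.wireV w s) (L.clauseV w.1 (L.clausePort w))
  | wireDirect (w : φ.Wire) (h : L.t w = 0) :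
      Link (L.varV (φ.lit w).1 (L.varPort w)) (L.clauseV w.1 (L.clausePort w))

/-- The vertex cover graph of the formula. -/
def graph : SimpleGraph L.Vertex := SimpleGraph.fromRel L.Link

open Classical in
/-- The set of edges of the graph. -/
def edges : Finset (Sym2 L.Vertex) := L.graph.edgeFinset

/-- The number of centers, `4 n_v + 5 n_3 + n_2 + ∑ t_w`. -/
def numCenters : ℕ :=
  4 * n + 5 * φ.numClauses 3 + φ.numClauses 2 + ∑ w : φ.Wire, L.t w

/-! ### The embedding and the clustering instance -/

/-- The points `Pt v` embed the graph so that the edges are partitioned into the set `E₁` of edges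
of length `2` and the set `E₂` of edges of length `2 * √2`, and so that the midpoint of every edge
has squared distance at least `4` from every non-incident embedded vertex. -/
structure IsEmbedding {d : ℕ} (Pt : L.Vertex → EuclideanSpace ℝ (Fin d))
    (E₁ E₂ : Finset (Sym2 L.Vertex)) : Prop where
  disjoint : Disjoint E₁ E₂
  cover : ∀ e, e ∈ L.edges ↔ e ∈ E₁ ∨ e ∈ E₂
  length_one : ∀ u v, s(u, v) ∈ E₁ → dist (Pt u) (Pt v) = 2
  length_two : ∀ u v, s(u, v) ∈ E₂ → dist (Pt u) (Pt v) = 2 * √2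
  midpoint_far : ∀ u v, s(u, v) ∈ L.edges → ∀ x, x ≠ u → x ≠ v →
    4 ≤ dist (midpoint ℝ (Pt u) (Pt v)) (Pt x) ^ 2

open Classical in
/-- The candidate centers: all embedded vertices. -/
def candidates {d : ℕ} (Pt : L.Vertex → EuclideanSpace ℝ (Fin d)) :
    Finset (EuclideanSpace ℝ (Fin d)) :=
  Finset.univ.image Pt

/-- The midpoint of an embedded edge. -/
def edgeMidpoint {d : ℕ} (Pt : L.Vertex → EuclideanSpace ℝ (Fin d)) :
    Sym2 L.Vertex → EuclideanSpace ℝ (Fin d) :=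
  Sym2.lift ⟨fun u v => midpoint ℝ (Pt u) (Pt v), fun _ _ => midpoint_comm _ _⟩

open Classical in
/-- The clients: the midpoints of all edges. -/
def clients {d : ℕ} (Pt : L.Vertex → EuclideanSpace ℝ (Fin d)) :
    Finset (EuclideanSpace ℝ (Fin d)) :=
  L.edges.image (L.edgeMidpoint Pt)

end Layout

/-- A solution of discrete clustering: a set of exactly `k` candidate centers. -/
def IsSolution {d : ℕ} (C : Finset (EuclideanSpace ℝ (Fin d))) (k : ℕ)
    (S : Finset (EuclideanSpace ℝ (Fin d))) : Prop :=
  S ⊆ C ∧ S.card = k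

/-- The clustering cost `∑ p ∈ P, dist(p, S) ^ z`, with `z = 2` for `k`-means and `z = 1` for
`k`-median. -/
def cost {d : ℕ} (z : ℕ) (P S : Finset (EuclideanSpace ℝ (Fin d))) : ℝ :=
  ∑ p ∈ P, Metric.infDist p (S : Set (EuclideanSpace ℝ (Fin d))) ^ z

/-! ### Input and output of the decoding algorithm -/

/-- The input alphabet: a marker that opens the description of each variable gadget, clause gadget
and wire, tally marks and an end mark for numbers in unary, and bits. -/
inductive Tok
  | variable
  | clause
  | wire
  | tally
  | endMark
  | bit (b : Bool)

/-- A number in unary. -/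
def unary (a : ℕ) : List Tok := List.replicate a Tok.tally ++ [Tok.endMark]

namespace Layout

variable {n m : ℕ} {φ : CNF33 n m} (L : Layout φ)

open Classical in
/-- The bit that tells whether the vertex `v` is in `C`. -/
def memBit (C : Set L.Vertex) (v : L.Vertex) : Tok := Tok.bit (decide (v ∈ C))

/-- The description of a wire: its variable, the sign of its literal, the two vertices to which it
is attached, and, for each of its inner vertices, whether it is in `C`. -/
def encodeWire (C : Set L.Vertex) (w : φ.Wire) : List Tok :=
  Tok.wire :: unary (φ.lit w).1 ++ [Tok.bit (φ.lit w).2] ++ unary (L.varPort w) ++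
    unary (L.clausePort w) ++ (List.finRange (2 * L.t w)).map fun s => L.memBit C (L.wireV w s)

/-- The formula, its graph and a set `C` of vertices as a string: all variable gadgets, then all
clause gadgets, each followed by its wires; every vertex comes with its membership bit. -/
def encode (C : Set L.Vertex) : List Tok :=
  ((List.finRange n).flatMap fun i =>
    Tok.variable :: (List.finRange 8).map fun a => L.memBit C (L.varV i a)) ++
  (List.finRange m).flatMap fun j =>
    Tok.clause :: ((List.finRange (φ.gadgetSize j)).map fun a => L.memBit C (L.clauseV j a)) ++
      (List.finRange (φ.clause j).length).flatMap fun q => L.encodeWire C ⟨j, q⟩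

end Layout

/-- The Turing machine `M`, started on the string `x`, halts within `T` steps with output the
values of the assignment `α`. -/
def Outputs (M : Turing.TM2ComputableAux Tok Bool) (x : List Tok) {n : ℕ} (α : Fin n → Bool)
    (T : ℕ) : Prop :=
  Nonempty (Turing.TM2OutputsInTime M.tm (x.map M.inputAlphabet.invFun)
    (some ((List.ofFn α).map M.outputAlphabet.invFun)) T)

end VCClustering

end

open VCClustering

/-! Let C be the set of vertices embedded into S, and let U be the number of edges that C leaves
uncovered. Every edge costs at least 1 or √2 ^ z, according to its length. An uncovered edge costs
at least 2 ^ z, which is more by at least 1/2. The cost bound therefore forces U ≤ 4ε|E|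
(`card_uncovered_le`).

The variable cycles, the clause gadgets and the interiors of the wires partition the vertices. Each
of these gadgets needs a certain number of vertices to cover its edges, and the needs add up to k. A
gadget can undercut its need only by leaving edges uncovered. Since |C| = k, at most 12U gadgets
fail to be tight, that is, to use exactly their need and cover all their edges
(`card_not_tight_le`).

Tight gadgets carry the logic. A tight clause gadget has an unselected port; a tight wire at that
port must have its variable end selected; a tight variable cycle alternates, so the parity of that
end makes the literal true when the variable is read off from vertex 0 of its cycle
(`satisfies_of_port`). A variable occurs in at most three clauses, so a non-tight gadget spoils at
most three of them, and at most 36U ≤ 144ε|E| clauses fail (`le_numSatisfied_add`). The decoder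
merely copies one membership bit per variable, in two linear passes. -/

noncomputable section

namespace VCClustering

/-! ### A machine that outputs the bit after each variable marker -/

/-- Is the token the marker of a variable gadget? -/
def Tok.isVariable : Tok → Bool
  | .variable => true
  | _ => false

/-- The value of a bit, and `false` for every other token. -/
def Tok.value : Tok → Bool
  | .bit b => b
  | _ => false

instance : Finite Tok :=
  Finite.of_surjective
    (fun o : Fin 5 ⊕ Bool => Sum.elim
      ![Tok.variable, Tok.clause, Tok.wire, Tok.tally, Tok.endMark] Tok.bit o) fun t => by
    cases t
    · exact ⟨Sum.inl 0, rfl⟩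
    · exact ⟨Sum.inl 1, rfl⟩
    · exact ⟨Sum.inl 2, rfl⟩
    · exact ⟨Sum.inl 3, rfl⟩
    · exact ⟨Sum.inl 4, rfl⟩
    · exact ⟨Sum.inr _, rfl⟩

instance : Fintype Tok := Fintype.ofFinite Tok

namespace Decoder

/-- The values of the tokens that directly follow a variable marker; `e` tells whether the token
before the string is such a marker. -/
def decode : Bool → List Tok → List Bool
  | _, [] => []
  | true, t :: x => t.value :: decode t.isVariable x
  | false, t :: x => decode t.isVariable x

/-- The contents of the machine. -/
inductive Stack
  | input
  | store
  | output
  deriving DecidableEq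

instance : Fintype Stack :=
  ⟨{.input, .store, .output}, fun k => by cases k <;> simp⟩

/-- The alphabets of the contents. -/
def Alphabet : Stack → Type
  | .input => Tok
  | .store => Bool
  | .output => Bool

/-- The labels of the machine: it scans the input, then it reverses the stored bits. -/
inductive Label
  | scan
  | rev
  deriving DecidableEq

instance : Fintype Label := ⟨{.scan, .rev}, fun k => by cases k <;> simp⟩

/-- The internal state: whether the token before the last one was a variable marker, and the last
token (if any). -/
abbrev State : Type := Bool × Option Tok

/-- The program. -/
def program : Label → Turing.TM2.Stmt Alphabet Label State
  | .scan =>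
    .pop .input (fun v (t : Option Tok) => ((v.2.map Tok.isVariable).getD false, t)) <|
    .branch (fun v => v.2.isSome)
      (.branch (fun v => v.1)
        (.push .store (fun v => ((v.2.map Tok.value).getD false : Bool)) (.goto fun _ => .scan))
        (.goto fun _ => .scan))
      (.goto fun _ => .rev)
  | .rev =>
    .pop .store (fun _ (b : Option Bool) => (false, b.map Tok.bit)) <|
    .branch (fun v => v.2.isSome)
      (.push .output (fun v => ((v.2.map Tok.value).getD false : Bool)) (.goto fun _ => .rev))
      .halt

/-- The machine. -/
def machine : Turing.FinTM2 where
  K := Stack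
  k₀ := .input
  k₁ := .output
  Γ := Alphabet
  Λ := Label
  main := .scan
  σ := State
  initialState := (false, none)
  Γk₀Fin := inferInstanceAs (Fintype Tok)
  m := program

/-- The machine with its input and output alphabets. -/
def decoder : Turing.TM2ComputableAux Tok Bool where
  tm := machine
  inputAlphabet := Equiv.refl Tok
  outputAlphabet := Equiv.refl Bool

/-- The stacks with given contents. -/
def contents (x : List Tok) (s o : List Bool) : (k : Stack) → List (Alphabet k)
  | .input => x
  | .store => s
  | .output => o

theorem update_input (x y : List Tok) (s o : List Bool) :
    Function.update (contents x s o) .input y = contents y s o := by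
  funext k; cases k <;> rfl

theorem update_store (x : List Tok) (s r o : List Bool) :
    Function.update (contents x s o) .store r = contents x r o := by
  funext k; cases k <;> rfl

theorem update_output (x : List Tok) (s o r : List Bool) :
    Function.update (contents x s o) .output r = contents x s r := by
  funext k; cases k <;> rfl

/-- A configuration of the machine. -/
def cfg (l : Option Label) (v : State) (x : List Tok) (s o : List Bool) : machine.Cfg :=
  ⟨l, v, contents x s o⟩

theorem step_scan_nil (v : State) (s o : List Bool) :
    machine.step (cfg (some .scan) v [] s o) =
      some (cfg (some .rev) ((v.2.map Tok.isVariable).getD false, none) [] s o) :=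
  congrArg (fun S => some (Turing.TM2.Cfg.mk (some Label.rev) (_, none) S))
    (update_input [] [] s o)

theorem step_scan_cons (v : State) (t : Tok) (x : List Tok) (s o : List Bool) :
    machine.step (cfg (some .scan) v (t :: x) s o) =
      some (cfg (some .scan) ((v.2.map Tok.isVariable).getD false, some t) x
        (if (v.2.map Tok.isVariable).getD false then t.value :: s else s) o) := by
  have h : Function.update (contents (t :: x) s o) .input x = contents x s o := update_input _ _ s o
  have h2 : Function.update (Function.update (contents (t :: x) s o) .input x) .store
      (t.value :: s) = contents x (t.value :: s) o := by
    rw [h]; exact update_store ..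
  have h3 := fun e : Bool => congrArg
    (fun S => some (Turing.TM2.Cfg.mk (some Label.scan) (e, some t) S)) h
  have h4 := fun e : Bool => congrArg
    (fun S => some (Turing.TM2.Cfg.mk (some Label.scan) (e, some t) S)) h2
  -- The branch reduces by computation only once the previous token is a concrete constructor.
  rcases v with ⟨e, _ | t'⟩
  · exact h3 _
  · cases t' <;> first | exact h3 _ | exact h4 _

theorem step_rev_nil (v : State) (x : List Tok) (o : List Bool) :
    machine.step (cfg (some .rev) v x [] o) = some (cfg none (false, none) x [] o) :=
  congrArg (fun S => some (Turing.TM2.Cfg.mk none (false, none) S)) (update_store x [] [] o)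

theorem step_rev_cons (v : State) (x : List Tok) (b : Bool) (s o : List Bool) :
    machine.step (cfg (some .rev) v x (b :: s) o) =
      some (cfg (some .rev) (false, some (.bit b)) x s (b :: o)) := by
  have h : Function.update (Function.update (contents x (b :: s) o) .store s) .output
      (b :: o) = contents x s (b :: o) := by
    rw [update_store]; exact update_output ..
  exact congrArg
    (fun S => some (Turing.TM2.Cfg.mk (some Label.rev) (false, some (Tok.bit b)) S)) h

/-- The configuration after `r` steps. -/
abbrev run (r : ℕ) (c : Option machine.Cfg) : Option machine.Cfg :=
  (flip bind machine.step)^[r] c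

theorem run_succ {r : ℕ} {c c' : machine.Cfg} (h : machine.step c = some c') :
    run (r + 1) (some c) = run r (some c') := by
  rw [run, Function.iterate_succ_apply]
  exact congrArg _ h

/-- A stack receives the bits in reverse order. The extra step is the one that finds the input
empty. -/
theorem run_scan (x : List Tok) (v : State) (s : List Bool) : ∃ v',
    run (x.length + 1) (some (cfg (some .scan) v x s [])) =
      some (cfg (some .rev) v' []
        ((decode ((v.2.map Tok.isVariable).getD false) x).reverse ++ s) []) := by
  induction x generalizing v s with
  | nil => exact ⟨_, run_succ (step_scan_nil v s [])⟩
  | cons t x ih =>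
    obtain ⟨v', h⟩ := ih _ _
    refine ⟨v', (run_succ (step_scan_cons v t x s [])).trans (h.trans ?_)⟩
    cases hv : (v.2.map Tok.isVariable).getD false <;> simp [decode]

theorem run_rev (s o : List Bool) (v : State) :
    run (s.length + 1) (some (cfg (some .rev) v [] s o)) =
      some (cfg none (false, none) [] [] (s.reverse ++ o)) := by
  induction s generalizing v o with
  | nil => exact run_succ (step_rev_nil v [] o)
  | cons b s ih =>
    refine (run_succ (step_rev_cons v [] b s o)).trans ((ih _ _).trans ?_)
    simp

theorem length_decode_le (e : Bool) (x : List Tok) : (decode e x).length ≤ x.length := by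
  induction x generalizing e with
  | nil => simp [decode]
  | cons t x ih => cases e <;> simp [decode] <;> have := ih t.isVariable <;> omega

/-- Both passes take at most `x.length + 1` steps, because no more bits are stored than tokens are
read. -/
theorem outputs_decode (x : List Tok) {n : ℕ} (α : Fin n → Bool) (T : ℕ)
    (hα : decode false x = List.ofFn α) (hT : 2 * x.length + 2 ≤ T) :
    Outputs decoder x α T := by
  obtain ⟨v', h⟩ := run_scan x (false, none) []
  have hl := length_decode_le false x
  -- Iterates compose from the right, so the scan is the second summand.
  refine ⟨⟨⟨((decode false x).length + 1) + (x.length + 1), ?_⟩, by simp only; omega⟩⟩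
  have h0 : Turing.initList decoder.tm (x.map decoder.inputAlphabet.invFun) =
      cfg (some .scan) (false, none) x [] [] := by
    have : x.map decoder.inputAlphabet.invFun = x := List.map_id x
    rw [this]
    exact congrArg (Turing.TM2.Cfg.mk _ _) (funext fun k => by cases k <;> rfl)
  have h1 : Turing.haltList decoder.tm ((List.ofFn α).map decoder.outputAlphabet.invFun) =
      cfg none (false, none) [] [] (List.ofFn α) := by
    have : (List.ofFn α).map decoder.outputAlphabet.invFun = List.ofFn α := List.map_id _
    rw [this]
    exact congrArg (Turing.TM2.Cfg.mk _ _) (funext fun k => by cases k <;> rfl)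
  rw [h0, Function.iterate_add_apply, Option.map_some, h1]
  refine (congrArg _ h).trans ?_
  have h2 := run_rev ((decode false x).reverse ++ []) [] v'
  simp only [List.append_nil, List.length_reverse, List.reverse_reverse] at h2
  simp only [List.append_nil]
  rw [← hα]
  exact h2

/-! ### The machine on encoded inputs -/

theorem decode_false_append {x : List Tok} (hx : ∀ t ∈ x, t.isVariable = false) (y : List Tok) :
    decode false (x ++ y) = decode false y := by
  induction x with
  | nil => rfl
  | cons t x ih =>
    simp only [List.cons_append, decode, hx t List.mem_cons_self]
    exact ih fun s hs => hx s (List.mem_cons_of_mem _ hs)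

theorem decode_true_cons_append {t : Tok} {x : List Tok}
    (hx : ∀ s ∈ t :: x, s.isVariable = false) (y : List Tok) :
    decode true (t :: x ++ y) = t.value :: decode false y := by
  simp only [List.cons_append, decode, hx t List.mem_cons_self]
  rw [decode_false_append fun s hs => hx s (List.mem_cons_of_mem _ hs)]

theorem decode_flatMap_variable {ι : Type} (l : List ι) (f : ι → Tok) (g : ι → List Tok)
    (hf : ∀ i, (f i).isVariable = false) (hg : ∀ i, ∀ t ∈ g i, t.isVariable = false)
    (y : List Tok) :
    decode false (l.flatMap (fun i => Tok.variable :: f i :: g i) ++ y) =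
      l.map (fun i => (f i).value) ++ decode false y := by
  induction l with
  | nil => rfl
  | cons i l ih =>
    rw [List.flatMap_cons, List.append_assoc, List.cons_append, decode]
    change decode true _ = _
    rw [decode_true_cons_append, ih]
    · rfl
    · intro s hs
      rcases List.mem_cons.1 hs with rfl | hs
      exacts [hf i, hg i s hs]

end Decoder

open Decoder

theorem isVariable_of_mem_unary {a : ℕ} {t : Tok} (h : t ∈ unary a) : t.isVariable = false := by
  simp only [unary, List.mem_append, List.mem_replicate, List.mem_singleton] at h
  rcases h with ⟨-, rfl⟩ | rfl <;> rfl

namespace Layout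

variable {n m : ℕ} {φ : CNF33 n m} (L : Layout φ)

open Classical in
/-- The assignment read off from a vertex set: a variable is true if the first vertex of its cycle
is in the set. -/
def assignment (C : Set L.Vertex) (i : Fin n) : Bool := decide (L.varV i 0 ∈ C)

theorem isVariable_of_mem_encodeWire {C : Set L.Vertex} {w : φ.Wire} {t : Tok}
    (h : t ∈ L.encodeWire C w) : t.isVariable = false := by
  simp only [encodeWire, List.mem_append, List.mem_cons, List.mem_map, List.not_mem_nil,
    or_false] at h
  rcases h with (((((rfl | h) | rfl) | h) | h) | ⟨s, -, rfl⟩)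
  · rfl
  · exact isVariable_of_mem_unary h
  · rfl
  · exact isVariable_of_mem_unary h
  · exact isVariable_of_mem_unary h
  · rfl

theorem decode_encode (C : Set L.Vertex) :
    decode false (L.encode C) = List.ofFn (L.assignment C) := by
  -- Each block of eight bits is split into the bit of vertex 0, which is copied, and the other
  -- seven, which are skipped.
  have h := decode_flatMap_variable (List.finRange n) (fun i => L.memBit C (L.varV i 0))
    (fun i => (List.finRange 7).map fun a => L.memBit C (L.varV i a.succ))
    (fun _ => rfl) (fun i t ht => by obtain ⟨a, -, rfl⟩ := List.mem_map.1 ht; rfl)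
    ((List.finRange m).flatMap fun j =>
      Tok.clause :: ((List.finRange (φ.gadgetSize j)).map fun a => L.memBit C (L.clauseV j a)) ++
        (List.finRange (φ.clause j).length).flatMap fun q => L.encodeWire C ⟨j, q⟩)
  have h2 {y : List Tok} (hy : ∀ t ∈ y, t.isVariable = false) : decode false y = [] := by
    simpa [decode] using decode_false_append hy []
  have h3 := (h.trans (congrArg _ (h2 ?_)))
  · rw [List.append_nil, ← List.ofFn_eq_map] at h3
    refine Eq.trans ?_ h3
    simp only [encode, List.finRange_succ (n := 7), List.map_cons, List.map_map]
    rfl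
  · intro t ht
    obtain ⟨j, -, ht⟩ := List.mem_flatMap.1 ht
    rcases List.mem_append.1 ht with ht | ht
    · rcases List.mem_cons.1 ht with rfl | ht
      · rfl
      · obtain ⟨a, -, rfl⟩ := List.mem_map.1 ht
        rfl
    · obtain ⟨q, -, ht⟩ := List.mem_flatMap.1 ht
      exact L.isVariable_of_mem_encodeWire ht

/-! ### Length of the encoding -/

theorem length_flatMap_finRange_le {r b : ℕ} (f : Fin r → List Tok)
    (h : ∀ i, (f i).length ≤ b) : ((List.finRange r).flatMap f).length ≤ r * b := by
  rw [List.length_flatMap]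
  refine (List.sum_le_card_nsmul _ b ?_).trans ?_
  · intro x hx
    obtain ⟨i, -, rfl⟩ := List.mem_map.1 hx
    exact h i
  · simp

theorem gadgetSize_pos (j : Fin m) : 0 < φ.gadgetSize j := by
  unfold CNF33.gadgetSize; split <;> omega

theorem gadgetSize_le (j : Fin m) : φ.gadgetSize j ≤ 9 := by
  unfold CNF33.gadgetSize; split <;> omega

theorem length_encode_le (C : Set L.Vertex) :
    (L.encode C).length ≤
      6 * Fintype.card L.Vertex ^ 2 + 91 * Fintype.card L.Vertex := by
  set N := Fintype.card L.Vertex with hN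
  have hn : n ≤ N := by
    simpa only [Fintype.card_fin] using Fintype.card_le_of_injective (fun i => L.varV i 0) fun i i' h => by
      simpa [varV] using h
  have hm : m ≤ N := by
    simpa only [Fintype.card_fin] using Fintype.card_le_of_injective (fun j => L.clauseV j ⟨0, gadgetSize_pos j⟩)
      fun j j' h => by
        have := Sum.inl.inj (Sum.inr.inj h)
        exact congrArg Sigma.fst this
  have ht : ∀ w, 2 * L.t w ≤ N := fun w => by
    simpa only [Fintype.card_fin] using Fintype.card_le_of_injective (L.wireV w) fun s s' h => by
      simpa [wireV] using h
  have hwire : ∀ w, (L.encodeWire C w).length ≤ 2 * N + 24 := fun w => by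
    have h1 := (φ.lit w).1.2
    have h2 := (L.varPort w).2
    have h3 := (L.clausePort w).2
    have h4 := gadgetSize_le (φ := φ) w.1
    have h5 := ht w
    simp only [encodeWire, unary, List.length_append, List.length_cons, List.length_map,
      List.length_finRange, List.length_replicate, List.length_nil]
    omega
  unfold encode
  rw [List.length_append]
  have h1 := length_flatMap_finRange_le (b := 9)
    (fun i : Fin n => Tok.variable :: (List.finRange 8).map fun a => L.memBit C (L.varV i a))
    (fun i => by simp)
  -- A marker, at most nine gadget bits and at most three wires: 1 + 9 + 3 (2N + 24).
  have h2 := length_flatMap_finRange_le (b := 6 * N + 82)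
    (fun j : Fin m => Tok.clause ::
      ((List.finRange (φ.gadgetSize j)).map fun a => L.memBit C (L.clauseV j a)) ++
        (List.finRange (φ.clause j).length).flatMap fun q => L.encodeWire C ⟨j, q⟩)
    (fun j => by
      have h3 := length_flatMap_finRange_le
        (fun q : Fin (φ.clause j).length => L.encodeWire C ⟨j, q⟩) fun q => hwire _
      have h4 : (φ.clause j).length * (2 * N + 24) ≤ 3 * (2 * N + 24) :=
        Nat.mul_le_mul_right _ (by rcases φ.width j with h | h <;> omega)
      have h5 := gadgetSize_le (φ := φ) j
      simp only [List.length_append, List.length_cons, List.length_map, List.length_finRange]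
      omega)
  have h3 : m * (6 * N + 82) ≤ N * (6 * N + 82) := Nat.mul_le_mul_right _ hm
  nlinarith

end Layout

/-! ### Vertex covers of cycles and paths -/

/-- Summing over the edges of the cycle counts every vertex twice; `u` marks the uncovered edges. -/
theorem le_two_mul_sum_add_sum {N : ℕ} [NeZero N] (f u : Fin N → ℕ)
    (h : ∀ a, 1 ≤ f a + f (a + 1) + u a) : N ≤ 2 * ∑ a, f a + ∑ a, u a := by
  have h1 : ∑ a, f (a + 1) = ∑ a, f a := Equiv.sum_comp (Equiv.addRight (1 : Fin N)) f
  have h2 : ∑ _a : Fin N, 1 ≤ ∑ a, (f a + f (a + 1) + u a) := Finset.sum_le_sum fun a _ => h a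
  simp only [Finset.sum_add_distrib, h1, Finset.sum_const, Finset.card_univ, Fintype.card_fin,
    smul_eq_mul, mul_one] at h2
  omega

/-- The cycle is the union of two perfect matchings of four edges. Four vertices that cover it meet
each of these edges exactly once, so membership alternates. -/
theorem eight_cycle_alternates (f : Fin 8 → ℕ) (hf : ∀ a, f a ≤ 1)
    (hs : ∑ a, f a = 4) (h : ∀ a, 1 ≤ f a + f (a + 1)) (a : Fin 8) (ha : f a = 1) :
    f 0 = 1 ↔ Even a.val := by
  have h0 := h 0
  have h1 := h 1
  have h2 := h 2
  have h3 := h 3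
  have h4 := h 4
  have h5 := h 5
  have h6 := h 6
  have h7 := h 7
  have g := hf 0
  simp only [Fin.sum_univ_eight, Fin.reduceAdd] at *
  fin_cases a <;> simp at ha ⊢ <;> first | omega | (norm_num [Nat.even_iff]; omega)

/-- If all three ports were selected, the arcs between them would leave paths with 2r, 2s and 6 - 2r
- 2s inner vertices. Covering these takes three more vertices, hence six in total. The proof checks
the finitely many positions. -/
theorem nine_cycle_port (f : Fin 9 → ℕ) (hf : ∀ a, f a ≤ 1)
    (hs : ∑ a, f a = 5) (h : ∀ a, 1 ≤ f a + f (a + 1)) (x y z : Fin 9) (r s : ℕ)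
    (hy : y.val = x.val + (2 * r + 1)) (hz : z.val = y.val + (2 * s + 1)) :
    f x = 0 ∨ f y = 0 ∨ f z = 0 := by
  have h0 := h 0
  have h1 := h 1
  have h2 := h 2
  have h3 := h 3
  have h4 := h 4
  have h5 := h 5
  have h6 := h 6
  have h7 := h 7
  have h8 := h 8
  have gx := hf x
  have gy := hf y
  have gz := hf z
  simp only [Fin.sum_univ_succ, Fin.sum_univ_zero, Fin.reduceAdd, Fin.reduceSucc] at *
  clear h hf
  obtain ⟨x, hx⟩ := x
  obtain ⟨y, hy'⟩ := y
  obtain ⟨z, hz'⟩ := z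
  simp only at hy hz
  by_contra! hc
  obtain ⟨hc1, hc2, hc3⟩ := hc
  have hr : r < 4 := by omega
  have hs' : s < 4 := by omega
  interval_cases r <;> interval_cases s <;> interval_cases x <;> (try omega) <;>
    (subst hy; subst hz; simp at *; omega)

/-- The sizes are variables here so that they can be substituted, although the type of a port
depends on the clause. -/
theorem exists_port_eq_zero {N l k : ℕ} [NeZero N] (f : Fin N → ℕ) (p : Fin l → Fin N)
    (hN : l = 3 ∧ N = 9 ∧ k = 5 ∨ l = 2 ∧ N = 2 ∧ k = 1) (hf : ∀ a, f a ≤ 1)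
    (hs : ∑ a, f a = k) (h : ∀ a, 1 ≤ f a + f (a + 1))
    (hp : ∀ q q' : Fin l, q'.val = q.val + 1 → ∃ r : ℕ, (p q').val = (p q).val + (2 * r + 1)) :
    ∃ q, f (p q) = 0 := by
  rcases hN with ⟨rfl, rfl, rfl⟩ | ⟨rfl, rfl, rfl⟩
  · obtain ⟨r, hr⟩ := hp 0 1 rfl
    obtain ⟨s, hs'⟩ := hp 1 2 rfl
    rcases nine_cycle_port f hf hs h _ _ _ r s hr hs' with h | h | h
    exacts [⟨_, h⟩, ⟨_, h⟩, ⟨_, h⟩]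
  · obtain ⟨r, hr⟩ := hp 0 1 rfl
    have h0 : p 0 = 0 := Fin.ext (by simp only [Fin.val_zero]; omega)
    have h1 : p 1 = 1 := Fin.ext (by simp only [Fin.val_one]; omega)
    rw [Fin.sum_univ_two] at hs
    rcases Nat.eq_zero_or_pos (f 0) with h2 | h2
    · exact ⟨0, by rw [h0, h2]⟩
    · exact ⟨1, by rw [h1]; omega⟩

/-- The inner vertices are matched by the t edges (1,2), (3,4), ..., each of which contains a
selected vertex or is uncovered. -/
theorem path_le_sum (b u : ℕ → ℕ) (h : ∀ s, 1 ≤ b s + b (s + 1) + u s) (t : ℕ) :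
    t ≤ ∑ s ∈ Finset.range (2 * t), b (s + 1) + ∑ s ∈ Finset.range (2 * t + 1), u s := by
  induction t with
  | zero => simp
  | succ t ih =>
    have h1 := h (2 * t + 1)
    rw [show 2 * (t + 1) = 2 * t + 1 + 1 by ring]
    simp only [Finset.sum_range_succ] at ih ⊢
    omega

/-- The t + 1 disjoint edges (0,1), (2,3), ..., (2t, 2t+1) each contain a selected vertex, which is
never vertex 0. -/
theorem path_lt_sum (b : ℕ → ℕ) (t : ℕ) (h : ∀ s ≤ 2 * t, 1 ≤ b s + b (s + 1)) (h0 : b 0 = 0) :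
    t + 1 ≤ ∑ s ∈ Finset.range (2 * t + 1), b (s + 1) := by
  induction t with
  | zero => simpa [h0] using h 0 (by omega)
  | succ t ih =>
    have h1 := h (2 * t + 1 + 1) (by omega)
    have := ih fun s hs => h s (by omega)
    rw [show 2 * (t + 1) + 1 = 2 * t + 1 + 1 + 1 by ring, Finset.sum_range_succ,
      Finset.sum_range_succ]
    have h2 : b (2 * t + 2 + 1) = b (2 * t + 1 + 1 + 1) := rfl
    omega

/-! ### Indicators and uncovered edges -/

namespace Layout

variable {n m : ℕ} {φ : CNF33 n m} (L : Layout φ)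

instance (j : Fin m) : NeZero (φ.gadgetSize j) := ⟨(gadgetSize_pos j).ne'⟩

open Classical in
/-- The indicator of the vertex set `C`. -/
def ind (C : Set L.Vertex) (v : L.Vertex) : ℕ := if v ∈ C then 1 else 0

open Classical in
/-- The indicator of the pairs of vertices outside `C`. -/
def unc (C : Set L.Vertex) (u v : L.Vertex) : ℕ := if u ∉ C ∧ v ∉ C then 1 else 0

open Classical in
/-- The edges that are not covered by the vertex set `C`. -/
def uncovered (C : Set L.Vertex) : Finset (Sym2 L.Vertex) :=
  L.edges.filter fun e => ∀ v ∈ e, v ∉ C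

variable {L} (C : Set L.Vertex)

theorem ind_le_one (v : L.Vertex) : L.ind C v ≤ 1 := by unfold ind; split <;> omega

theorem one_le_ind_add (u v : L.Vertex) : 1 ≤ L.ind C u + L.ind C v + L.unc C u v := by
  unfold ind unc
  by_cases hu : u ∈ C <;> by_cases hv : v ∈ C <;> simp [hu, hv]

theorem unc_comm (u v : L.Vertex) : L.unc C u v = L.unc C v u := by
  unfold unc; by_cases hu : u ∈ C <;> by_cases hv : v ∈ C <;> simp [hu, hv]

open Classical in
theorem mem_edges {u v : L.Vertex} : s(u, v) ∈ L.edges ↔ L.graph.Adj u v := by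
  unfold edges
  rw [SimpleGraph.mem_edgeFinset, SimpleGraph.mem_edgeSet]

theorem mem_uncovered {u v : L.Vertex} :
    s(u, v) ∈ L.uncovered C ↔ L.graph.Adj u v ∧ u ∉ C ∧ v ∉ C := by
  simp [uncovered, mem_edges]

/-- An edge {x, y} is listed only for indices with `p i` equal to x or y, so at most twice. This
does occur: a gadget of size two, run through cyclically, lists its single edge twice. -/
theorem sum_unc_le {ι : Type} [Fintype ι] (p q : ι → L.Vertex)
    (hadj : ∀ i, L.graph.Adj (p i) (q i)) (hp : Function.Injective p) :
    ∑ i, L.unc C (p i) (q i) ≤ 2 * (L.uncovered C).card := by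
  classical
  unfold unc
  rw [← Finset.card_filter]
  refine Finset.card_le_mul_card_image_of_maps_to (f := fun i => s(p i, q i)) ?_ 2 ?_
  · intro i hi
    exact (mem_uncovered C).2 ⟨hadj i, (Finset.mem_filter.1 hi).2⟩
  · intro e _
    induction e using Sym2.ind with
    | _ x y =>
      refine (Finset.card_le_card_of_injOn p (t := {x, y}) ?_ hp.injOn).trans
        Finset.card_le_two
      intro i hi
      have := (Finset.mem_filter.1 hi).2
      rcases Sym2.eq_iff.1 this with h | h <;> simp [h.1]

/-! ### The gadgets -/

theorem adj_of_link {u v : L.Vertex} (h : L.Link u v) (hne : u ≠ v) : L.graph.Adj u v :=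
  (SimpleGraph.fromRel_adj _ _ _).2 ⟨hne, Or.inl h⟩

theorem varV_adj (i : Fin n) (a : Fin 8) : L.graph.Adj (L.varV i a) (L.varV i (a + 1)) := by
  refine adj_of_link (.varCycle i a) fun h => ?_
  have : a = a + 1 := (Prod.mk.inj (Sum.inl.inj h)).2
  revert this; clear h; decide +revert

theorem two_le_gadgetSize (j : Fin m) : 2 ≤ φ.gadgetSize j := by
  unfold CNF33.gadgetSize; split <;> omega

theorem clauseV_adj (j : Fin m) (a : Fin (φ.gadgetSize j)) :
    L.graph.Adj (L.clauseV j a) (L.clauseV j (a + 1)) := by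
  have h2 := two_le_gadgetSize (φ := φ) j
  have hv : (a + 1).val = (a.val + 1) % φ.gadgetSize j := by
    rw [Fin.val_add, Fin.val_one', Nat.add_mod_mod]
  refine adj_of_link (.clauseGadget j a (a + 1) hv) fun h => ?_
  have h3 : a = a + 1 := by simpa [clauseV] using h
  have h4 : a.val = (a.val + 1) % φ.gadgetSize j := by rw [← hv, ← h3]
  rcases Nat.lt_or_ge (a.val + 1) (φ.gadgetSize j) with h5 | h5
  · rw [Nat.mod_eq_of_lt h5] at h4; omega
  · have : a.val + 1 = φ.gadgetSize j := by omega
    rw [this, Nat.mod_self] at h4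
    omega

variable (L) in
/-- The vertices along a wire, from the variable cycle (`s = 0`) to the clause gadget
(`s = 2 * t w + 1`). -/
def wirePt (w : φ.Wire) (s : ℕ) : L.Vertex :=
  if s = 0 then L.varV (φ.lit w).1 (L.varPort w)
  else if h : s - 1 < 2 * L.t w then L.wireV w ⟨s - 1, h⟩
  else L.clauseV w.1 (L.clausePort w)

theorem wirePt_zero (w : φ.Wire) : L.wirePt w 0 = L.varV (φ.lit w).1 (L.varPort w) := by
  simp [wirePt]

theorem wirePt_succ (w : φ.Wire) {s : ℕ} (h : s < 2 * L.t w) :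
    L.wirePt w (s + 1) = L.wireV w ⟨s, h⟩ := by
  simp [wirePt, h]

theorem wirePt_last (w : φ.Wire) :
    L.wirePt w (2 * L.t w + 1) = L.clauseV w.1 (L.clausePort w) := by
  simp [wirePt]

theorem wirePt_adj (w : φ.Wire) {s : ℕ} (hs : s ≤ 2 * L.t w) :
    L.graph.Adj (L.wirePt w s) (L.wirePt w (s + 1)) := by
  rcases s with _ | s
  · rw [wirePt_zero]
    rcases Nat.eq_zero_or_pos (L.t w) with ht | ht
    · have := wirePt_last (L := L) w
      rw [ht] at this
      rw [this]
      exact adj_of_link (.wireDirect w ht) (by simp [varV, clauseV])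
    · rw [wirePt_succ w (by omega : 0 < 2 * L.t w)]
      exact adj_of_link (.wireStart w _ rfl) (by simp [varV, wireV])
  · rw [wirePt_succ w (by omega : s < 2 * L.t w)]
    rcases Nat.lt_or_ge (s + 1) (2 * L.t w) with h | h
    · rw [wirePt_succ w h]
      exact adj_of_link (.wirePath w _ _ rfl) (by simp [wireV])
    · have : s + 1 = 2 * L.t w := by omega
      rw [this, wirePt_last]
      exact adj_of_link (.wireEnd w _ this) (by simp [wireV, clauseV])

theorem clausePort_lt (j : Fin m) (q q' : Fin (φ.clause j).length) (h : q < q') :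
    L.clausePort ⟨j, q⟩ < L.clausePort ⟨j, q'⟩ := by
  have hq : q.val < q'.val := h
  have key : ∀ k, ∀ hk : k < (φ.clause j).length, q.val < k →
      L.clausePort ⟨j, q⟩ < L.clausePort ⟨j, ⟨k, hk⟩⟩ := by
    intro k
    induction k with
    | zero => intro _ h; omega
    | succ k ih =>
      intro hk hlt
      obtain ⟨r, hr⟩ := L.clausePort_odd j ⟨k, by omega⟩ ⟨k + 1, hk⟩ rfl
      rcases Nat.lt_or_ge q.val k with h1 | h1
      · have := ih (by omega) h1
        rw [Fin.lt_def] at this ⊢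
        omega
      · have : q = ⟨k, by omega⟩ := Fin.ext (by simp only; omega)
        rw [this, Fin.lt_def]
        omega
  exact key q' q'.2 hq

/-- Each edge of a wire is indexed by its end nearer to the clause. The other end would not do,
since several wires may start at the same vertex of a variable cycle. -/
theorem wirePt_succ_injective :
    Function.Injective fun x : Σ w : φ.Wire, Fin (2 * L.t w + 1) => L.wirePt x.1 (x.2 + 1) := by
  rintro ⟨w, s, hs⟩ ⟨w', s', hs'⟩ h
  simp only at h
  rcases Nat.lt_or_ge s (2 * L.t w) with h1 | h1 <;>
    rcases Nat.lt_or_ge s' (2 * L.t w') with h2 | h2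
  · rw [wirePt_succ w h1, wirePt_succ w' h2] at h
    have := Sum.inr.inj (Sum.inr.inj h)
    rw [Sigma.mk.injEq] at this
    obtain ⟨rfl, h3⟩ := this
    have := Fin.mk.inj (eq_of_heq h3)
    subst this
    rfl
  · have : s' = 2 * L.t w' := by omega
    subst this
    rw [wirePt_succ w h1, wirePt_last] at h
    simp [wireV, clauseV] at h
  · have : s = 2 * L.t w := by omega
    subst this
    rw [wirePt_succ w' h2, wirePt_last] at h
    simp [wireV, clauseV] at h
  · have : s = 2 * L.t w := by omega
    subst this
    have : s' = 2 * L.t w' := by omega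
    subst this
    rw [wirePt_last, wirePt_last] at h
    have h3 := Sum.inl.inj (Sum.inr.inj h)
    obtain ⟨j, q⟩ := w
    obtain ⟨j', q'⟩ := w'
    rw [Sigma.mk.injEq] at h3
    obtain ⟨rfl, h3⟩ := h3
    have h3 := eq_of_heq h3
    rcases lt_trichotomy q q' with h4 | rfl | h4
    · exact absurd h3 (clausePort_lt j q q' h4).ne
    · rfl
    · exact absurd h3 (clausePort_lt j q' q h4).ne'

end Layout

namespace Layout

variable {n m : ℕ} {φ : CNF33 n m} {L : Layout φ} (C : Set L.Vertex)

/-! ### Counting the gadgets that are not covered tightly -/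

/-- The number of centers that the gadget of the clause `j` needs. -/
def need (φ : CNF33 n m) (j : Fin m) : ℕ := if (φ.clause j).length = 3 then 5 else 1

/-- The cycle of the variable `i` is covered by four vertices. -/
def TightVar (i : Fin n) : Prop :=
  ∑ a, L.ind C (L.varV i a) = 4 ∧ ∑ a, L.unc C (L.varV i a) (L.varV i (a + 1)) = 0

/-- The gadget of the clause `j` is covered by as few vertices as possible. -/
def TightClause (j : Fin m) : Prop :=
  ∑ a, L.ind C (L.clauseV j a) = need φ j ∧
    ∑ a, L.unc C (L.clauseV j a) (L.clauseV j (a + 1)) = 0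

/-- The wire `w` is covered by `t w` inner vertices and its ends. -/
def TightWire (w : φ.Wire) : Prop :=
  ∑ s, L.ind C (L.wireV w s) = L.t w ∧
    ∑ s : Fin (2 * L.t w + 1), L.unc C (L.wirePt w (s + 1)) (L.wirePt w s) = 0

/-- If u = 0, failing to be tight means c > a. If u > 0, the second copy of u pays for the 1. -/
theorem add_ite_le {a c u : ℕ} {p : Prop} [Decidable (¬ p)] (hp : p ↔ c = a ∧ u = 0)
    (h : a ≤ c + u) : a + (if ¬ p then 1 else 0) ≤ c + 2 * u := by
  by_cases hq : p
  · simp only [hq, not_true_eq_false, if_false]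
    omega
  · simp only [hq, not_false_eq_true, if_true]
    rw [hp] at hq
    omega

theorem four_le_var (i : Fin n) :
    4 ≤ ∑ a, L.ind C (L.varV i a) + ∑ a, L.unc C (L.varV i a) (L.varV i (a + 1)) := by
  have := le_two_mul_sum_add_sum (fun a => L.ind C (L.varV i a))
    (fun a => L.unc C (L.varV i a) (L.varV i (a + 1))) fun a => one_le_ind_add C _ _
  omega

theorem need_le_clause (j : Fin m) :
    need φ j ≤ ∑ a, L.ind C (L.clauseV j a) +
      ∑ a, L.unc C (L.clauseV j a) (L.clauseV j (a + 1)) := by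
  have := le_two_mul_sum_add_sum (fun a => L.ind C (L.clauseV j a))
    (fun a => L.unc C (L.clauseV j a) (L.clauseV j (a + 1))) fun a => one_le_ind_add C _ _
  -- On the nine-cycle half the length is rounded up: with no uncovered edge, 9 ≤ 2c forces c ≥ 5.
  have h : 2 * need φ j ≤ φ.gadgetSize j + 1 := by
    unfold need CNF33.gadgetSize; split <;> omega
  omega

theorem sum_ind_wireV (w : φ.Wire) :
    ∑ s, L.ind C (L.wireV w s) =
      ∑ s ∈ Finset.range (2 * L.t w), L.ind C (L.wirePt w (s + 1)) := by
  rw [Finset.sum_range]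
  exact Finset.sum_congr rfl fun s _ => by rw [wirePt_succ w s.2]

theorem t_le_wire (w : φ.Wire) :
    L.t w ≤ ∑ s, L.ind C (L.wireV w s) +
      ∑ s : Fin (2 * L.t w + 1), L.unc C (L.wirePt w (s + 1)) (L.wirePt w s) := by
  rw [sum_ind_wireV, ← Finset.sum_range fun s => L.unc C (L.wirePt w (s + 1)) (L.wirePt w s)]
  refine path_le_sum (fun s => L.ind C (L.wirePt w s)) _ (fun s => ?_) _
  rw [unc_comm]
  exact one_le_ind_add C _ _

theorem sum_ind :
    ∑ v, L.ind C v = ∑ i, ∑ a, L.ind C (L.varV i a) + (∑ j, ∑ a, L.ind C (L.clauseV j a) +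
      ∑ w, ∑ s, L.ind C (L.wireV w s)) := by
  rw [Fintype.sum_sum_type, Fintype.sum_sum_type, Fintype.sum_prod_type, Fintype.sum_sigma,
    Fintype.sum_sigma]
  rfl

theorem numCenters_eq :
    L.numCenters = ∑ _i : Fin n, 4 + (∑ j, need φ j + ∑ w, L.t w) := by
  have h : ∑ j, need φ j = 5 * φ.numClauses 3 + φ.numClauses 2 := by
    unfold CNF33.numClauses
    rw [Finset.card_filter, Finset.card_filter, Finset.mul_sum, ← Finset.sum_add_distrib]
    refine Finset.sum_congr rfl fun j _ => ?_
    unfold need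
    rcases φ.width j with h | h <;> simp [h]
  rw [h, numCenters]
  simp
  ring

open Classical in
-- The factor 12 is 2 · 3 · 2: the coefficient 2 from `add_ite_le`, the three families of gadgets,
-- and each uncovered edge counted at most twice in a family.
theorem card_not_tight_le (hC : ∑ v, L.ind C v ≤ L.numCenters) :
    (Finset.univ.filter fun i : Fin n => ¬ TightVar C i).card +
      ((Finset.univ.filter fun j : Fin m => ¬ TightClause C j).card +
        (Finset.univ.filter fun w : φ.Wire => ¬ TightWire C w).card) ≤
      12 * (L.uncovered C).card := by
  have hv : ∑ i : Fin n, 4 + (Finset.univ.filter fun i : Fin n => ¬ TightVar C i).card ≤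
      ∑ i, ∑ a, L.ind C (L.varV i a) +
        2 * ∑ i, ∑ a, L.unc C (L.varV i a) (L.varV i (a + 1)) := by
    rw [Finset.card_filter, ← Finset.sum_add_distrib, Finset.mul_sum, ← Finset.sum_add_distrib]
    refine Finset.sum_le_sum fun i _ => ?_
    exact add_ite_le Iff.rfl (four_le_var C i)
  have hc : ∑ j, need φ j + (Finset.univ.filter fun j : Fin m => ¬ TightClause C j).card ≤
      ∑ j, ∑ a, L.ind C (L.clauseV j a) +
        2 * ∑ j, ∑ a, L.unc C (L.clauseV j a) (L.clauseV j (a + 1)) := by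
    rw [Finset.card_filter, ← Finset.sum_add_distrib, Finset.mul_sum, ← Finset.sum_add_distrib]
    refine Finset.sum_le_sum fun i _ => ?_
    exact add_ite_le Iff.rfl (need_le_clause C i)
  have hw : ∑ w, L.t w + (Finset.univ.filter fun w : φ.Wire => ¬ TightWire C w).card ≤
      ∑ w, ∑ s, L.ind C (L.wireV w s) +
        2 * ∑ w, ∑ s : Fin (2 * L.t w + 1), L.unc C (L.wirePt w (s + 1)) (L.wirePt w s) := by
    rw [Finset.card_filter, ← Finset.sum_add_distrib, Finset.mul_sum, ← Finset.sum_add_distrib]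
    refine Finset.sum_le_sum fun i _ => ?_
    exact add_ite_le Iff.rfl (t_le_wire C i)
  have uv := sum_unc_le C (fun x : Fin n × Fin 8 => L.varV x.1 x.2)
    (fun x => L.varV x.1 (x.2 + 1)) (fun x => varV_adj _ _) (fun x y h => Sum.inl.inj h)
  have uc := sum_unc_le C (fun x : Σ j, Fin (φ.gadgetSize j) => L.clauseV x.1 x.2)
    (fun x => L.clauseV x.1 (x.2 + 1)) (fun x => clauseV_adj _ _)
    (fun x y h => Sum.inl.inj (Sum.inr.inj h))
  have uw := sum_unc_le C
    (fun x : Σ w : φ.Wire, Fin (2 * L.t w + 1) => L.wirePt x.1 (x.2 + 1))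
    (fun x => L.wirePt x.1 x.2) (fun x => (wirePt_adj _ (by have := x.2.2; omega)).symm)
    wirePt_succ_injective
  rw [Fintype.sum_prod_type] at uv
  rw [Fintype.sum_sigma] at uc uw
  rw [sum_ind, numCenters_eq] at hC
  simp only at uv uc uw
  omega

/-! ### Clauses whose gadgets are covered tightly are satisfied -/

theorem satisfies_of_port {j : Fin m} (q : Fin (φ.clause j).length)
    (hp : L.ind C (L.clauseV j (L.clausePort ⟨j, q⟩)) = 0) (hw : TightWire C ⟨j, q⟩)
    (hv : TightVar C (φ.lit ⟨j, q⟩).1) : φ.Satisfies (L.assignment C) j := by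
  set w : φ.Wire := ⟨j, q⟩ with hwdef
  -- With both ends unselected, the wire would need t + 1 inner vertices, but a tight wire has only
  -- t.
  have h0 : L.ind C (L.wirePt w 0) = 1 := by
    by_contra h0
    have h0' : L.ind C (L.wirePt w 0) = 0 := by have := ind_le_one C (L.wirePt w 0); omega
    have h1 := path_lt_sum (fun s => L.ind C (L.wirePt w s)) (L.t w) (fun s hs => by
      have h2 := one_le_ind_add C (L.wirePt w s) (L.wirePt w (s + 1))
      have h3 := (Finset.sum_eq_zero_iff.1 hw.2) ⟨s, by omega⟩ (Finset.mem_univ _)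
      rw [unc_comm] at h3
      simp only at h3
      omega) h0'
    rw [Finset.sum_range_succ, ← sum_ind_wireV, hw.1, wirePt_last, hp] at h1
    omega
  rw [wirePt_zero] at h0
  have h1 := eight_cycle_alternates (fun a => L.ind C (L.varV (φ.lit w).1 a))
    (fun a => ind_le_one C _) hv.1 (fun a => by
      have h2 := one_le_ind_add C (L.varV (φ.lit w).1 a) (L.varV (φ.lit w).1 (a + 1))
      have h3 := (Finset.sum_eq_zero_iff.1 hv.2) a (Finset.mem_univ _)
      omega) (L.varPort w) h0
  rw [L.varPort_even] at h1
  refine ⟨φ.lit w, List.get_mem _ _, ?_⟩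
  have h2 : L.assignment C (φ.lit w).1 = true ↔ L.ind C (L.varV (φ.lit w).1 0) = 1 := by
    simp [assignment, ind]
  exact Bool.eq_iff_iff.2 (h2.trans h1)

theorem exists_port (j : Fin m) (hj : TightClause C j) :
    ∃ q : Fin (φ.clause j).length, L.ind C (L.clauseV j (L.clausePort ⟨j, q⟩)) = 0 := by
  have hcov : ∀ a, 1 ≤ L.ind C (L.clauseV j a) + L.ind C (L.clauseV j (a + 1)) := fun a => by
    have h2 := one_le_ind_add C (L.clauseV j a) (L.clauseV j (a + 1))
    have h3 := (Finset.sum_eq_zero_iff.1 hj.2) a (Finset.mem_univ _)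
    omega
  refine exists_port_eq_zero _ (fun q => L.clausePort ⟨j, q⟩) ?_
    (fun a => ind_le_one C (L.clauseV j a)) hj.1 hcov (L.clausePort_odd j)
  unfold need CNF33.gadgetSize
  rcases φ.width j with h | h <;> simp [h]

open Classical in
theorem le_numSatisfied_add (hC : ∑ v, L.ind C v ≤ L.numCenters) :
    m ≤ φ.numSatisfied (L.assignment C) + 36 * (L.uncovered C).card := by
  have h := card_not_tight_le C hC
  set BV := Finset.univ.filter fun i : Fin n => ¬ TightVar C i with hBV
  set BC := Finset.univ.filter fun j : Fin m => ¬ TightClause C j with hBC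
  set BW := Finset.univ.filter fun w : φ.Wire => ¬ TightWire C w with hBW
  set sat := Finset.univ.filter fun j : Fin m => φ.Satisfies (L.assignment C) j with hsat
  have hs : φ.numSatisfied (L.assignment C) = sat.card := by
    rw [CNF33.numSatisfied, Set.ncard_eq_toFinset_card']
    congr 1
    ext j
    simp [hsat]
  set occ := fun i : Fin n => Finset.univ.filter fun j : Fin m => ∃ b : Bool, (i, b) ∈ φ.clause j
  -- An unsatisfied clause is charged to its own gadget, to one of its wires or to one of its
  -- variables.
  have hsub : (Finset.univ : Finset (Fin m)) ⊆
      sat ∪ (BC ∪ (BW.image Sigma.fst ∪ BV.biUnion occ)) := by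
    intro j _
    by_contra hj
    simp only [Finset.mem_union, not_or] at hj
    obtain ⟨h1, h2, h3, h4⟩ := hj
    have h2 : TightClause C j := by simpa [hBC] using h2
    obtain ⟨q, hq⟩ := exists_port C j h2
    refine h1 (Finset.mem_filter.2 ⟨Finset.mem_univ _, satisfies_of_port C q hq ?_ ?_⟩)
    · by_contra hw
      exact h3 (Finset.mem_image.2 ⟨⟨j, q⟩, by simpa [hBW] using hw, rfl⟩)
    · by_contra hv
      refine h4 (Finset.mem_biUnion.2 ⟨(φ.lit ⟨j, q⟩).1, by simpa [hBV] using hv, ?_⟩)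
      exact Finset.mem_filter.2 ⟨Finset.mem_univ _, (φ.lit ⟨j, q⟩).2, List.get_mem _ _⟩
  have h1 := Finset.card_le_card hsub
  rw [Finset.card_univ, Fintype.card_fin] at h1
  have h2 := Finset.card_union_le sat (BC ∪ (BW.image Sigma.fst ∪ BV.biUnion occ))
  have h3 := Finset.card_union_le BC (BW.image Sigma.fst ∪ BV.biUnion occ)
  have h4 := Finset.card_union_le (BW.image Sigma.fst) (BV.biUnion occ)
  have h5 : (BW.image Sigma.fst).card ≤ BW.card := Finset.card_image_le
  have h6 : (BV.biUnion occ).card ≤ BV.card * 3 :=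
    Finset.card_biUnion_le_card_mul _ _ _ fun i _ => by
      convert φ.occurrences i
  omega

end Layout

namespace Layout

variable {n m : ℕ} {φ : CNF33 n m} {L : Layout φ}

/-! ### The cost of a solution -/

theorem exists_adj (v : L.Vertex) : ∃ w, L.graph.Adj v w := by
  rcases v with ⟨i, a⟩ | ⟨j, a⟩ | ⟨w, s⟩
  · exact ⟨_, varV_adj i a⟩
  · exact ⟨_, clauseV_adj j a⟩
  · have h := wirePt_adj (L := L) w (s := s + 1) (by have := s.2; omega)
    rw [wirePt_succ w s.2] at h
    exact ⟨_, h⟩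

theorem dist_edgeMidpoint {d : ℕ} (Pt : L.Vertex → EuclideanSpace ℝ (Fin d)) (x y : L.Vertex) :
    dist (L.edgeMidpoint Pt s(x, y)) (Pt x) = dist (Pt x) (Pt y) / 2 := by
  change dist (midpoint ℝ (Pt x) (Pt y)) (Pt x) = _
  rw [dist_midpoint_left, Real.norm_ofNat]
  ring

namespace IsEmbedding

variable {d : ℕ} {Pt : L.Vertex → EuclideanSpace ℝ (Fin d)} {E₁ E₂ : Finset (Sym2 L.Vertex)}

theorem two_le_dist (h : L.IsEmbedding Pt E₁ E₂) {e : Sym2 L.Vertex} (he : e ∈ L.edges)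
    {x : L.Vertex} (hx : x ∉ e) : 2 ≤ dist (L.edgeMidpoint Pt e) (Pt x) := by
  induction e using Sym2.ind with
  | _ u v =>
    rw [Sym2.mem_iff, not_or] at hx
    have : 4 ≤ dist (L.edgeMidpoint Pt s(u, v)) (Pt x) ^ 2 := h.midpoint_far u v he x hx.1 hx.2
    nlinarith [dist_nonneg (x := L.edgeMidpoint Pt s(u, v)) (y := Pt x)]

theorem dist_eq_one (h : L.IsEmbedding Pt E₁ E₂) {e : Sym2 L.Vertex} (he : e ∈ E₁)
    {x : L.Vertex} (hx : x ∈ e) : dist (L.edgeMidpoint Pt e) (Pt x) = 1 := by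
  obtain ⟨y, rfl⟩ := Sym2.mem_iff_exists.1 hx
  rw [dist_edgeMidpoint, h.length_one _ _ he]
  norm_num

theorem dist_eq_sqrt_two (h : L.IsEmbedding Pt E₁ E₂) {e : Sym2 L.Vertex} (he : e ∈ E₂)
    {x : L.Vertex} (hx : x ∈ e) : dist (L.edgeMidpoint Pt e) (Pt x) = √2 := by
  obtain ⟨y, rfl⟩ := Sym2.mem_iff_exists.1 hx
  rw [dist_edgeMidpoint, h.length_two _ _ he]
  ring

theorem sqrt_two_le : √2 ≤ 3 / 2 := Real.sqrt_le_iff.2 ⟨by norm_num, by norm_num⟩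

theorem dist_lt_two (h : L.IsEmbedding Pt E₁ E₂) {e : Sym2 L.Vertex} (he : e ∈ L.edges)
    {x : L.Vertex} (hx : x ∈ e) : dist (L.edgeMidpoint Pt e) (Pt x) < 2 := by
  rcases (h.cover e).1 he with h1 | h2
  · rw [h.dist_eq_one h1 hx]; norm_num
  · rw [h.dist_eq_sqrt_two h2 hx]; linarith [sqrt_two_le]

/-- An edge at x has its midpoint at distance less than 2 from `Pt x`, but at least 2 from every
vertex off the edge. The other end of the edge is at positive distance from `Pt x`. -/
theorem injective (h : L.IsEmbedding Pt E₁ E₂) : Function.Injective Pt := by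
  intro x y hxy
  by_contra hne
  obtain ⟨w, hw⟩ := exists_adj x
  have he := mem_edges.2 hw
  have h1 := h.dist_lt_two he (Sym2.mem_mk_left x w)
  by_cases hy : y = w
  · subst hy
    have h0 : dist (Pt x) (Pt y) = 0 := by rw [hxy, dist_self]
    rcases (h.cover _).1 he with h2 | h2
    · rw [h.length_one _ _ h2] at h0; norm_num at h0
    · rw [h.length_two _ _ h2] at h0; norm_num at h0
  · have h2 := h.two_le_dist he (x := y) (by
      rw [Sym2.mem_iff, not_or]; exact ⟨fun h => hne h.symm, hy⟩)
    rw [← hxy] at h2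
    linarith

/-- The endpoints of an edge are exactly the vertices at distance less than 2 from its midpoint.
Thus distinct edges give distinct clients, and the cost is a sum over edges. -/
theorem injOn_edgeMidpoint (h : L.IsEmbedding Pt E₁ E₂) :
    Set.InjOn (L.edgeMidpoint Pt) L.edges := by
  intro e he e' he' hee
  refine Sym2.ext fun x => ?_
  constructor <;> intro hx <;> by_contra hx'
  · have h1 := h.dist_lt_two he hx
    have h2 := h.two_le_dist he' hx'
    rw [hee] at h1
    linarith
  · have h1 := h.dist_lt_two he' hx
    have h2 := h.two_le_dist he hx'
    rw [hee] at h2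
    linarith

theorem cost_eq (h : L.IsEmbedding Pt E₁ E₂) (z : ℕ) (S : Finset (EuclideanSpace ℝ (Fin d))) :
    cost z (L.clients Pt) S =
      ∑ e ∈ E₁, Metric.infDist (L.edgeMidpoint Pt e) (S : Set (EuclideanSpace ℝ (Fin d))) ^ z +
      ∑ e ∈ E₂, Metric.infDist (L.edgeMidpoint Pt e) (S : Set (EuclideanSpace ℝ (Fin d))) ^ z := by
  classical
  have hE : L.edges = E₁ ∪ E₂ := by
    ext e; rw [h.cover, Finset.mem_union]
  rw [← Finset.sum_union h.disjoint, ← hE, cost]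
  have := Finset.sum_image (s := L.edges) (g := L.edgeMidpoint Pt)
    (f := fun p => Metric.infDist p (S : Set (EuclideanSpace ℝ (Fin d))) ^ z) h.injOn_edgeMidpoint
  rw [← this, clients]

theorem card_edges (h : L.IsEmbedding Pt E₁ E₂) : L.edges.card = E₁.card + E₂.card := by
  classical
  have hE : L.edges = E₁ ∪ E₂ := by
    ext e; rw [h.cover, Finset.mem_union]
  rw [hE, Finset.card_union_of_disjoint h.disjoint]

open Classical in
theorem card_uncovered (h : L.IsEmbedding Pt E₁ E₂) (C : Set L.Vertex) :
    (L.uncovered C).card = (E₁.filter fun e => ∀ v ∈ e, v ∉ C).card +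
      (E₂.filter fun e => ∀ v ∈ e, v ∉ C).card := by
  have hE : L.edges = E₁ ∪ E₂ := by
    ext e; rw [h.cover, Finset.mem_union]
  rw [← Finset.card_union_of_disjoint (Finset.disjoint_filter_filter h.disjoint),
    ← Finset.filter_union, ← hE]
  unfold uncovered
  congr!

/-- Nonemptiness matters: `Metric.infDist` to the empty set is 0. -/
theorem le_infDist (h : L.IsEmbedding Pt E₁ E₂) {S : Finset (EuclideanSpace ℝ (Fin d))}
    (hS : S ⊆ L.candidates Pt) (hne : S.Nonempty) {e : Sym2 L.Vertex} (he : e ∈ L.edges) {r : ℝ}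
    (hr : r ≤ 2) (hd : ∀ v ∈ e, Pt v ∈ S → r ≤ dist (L.edgeMidpoint Pt e) (Pt v)) :
    r ≤ Metric.infDist (L.edgeMidpoint Pt e) (S : Set (EuclideanSpace ℝ (Fin d))) := by
  refine (Metric.le_infDist hne).2 fun {y} hy => ?_
  obtain ⟨v, -, rfl⟩ := Finset.mem_image.1 (hS hy)
  by_cases hv : v ∈ e
  · exact hd v hv hy
  · exact hr.trans (h.two_le_dist he hv)

open Classical in
theorem sum_le (E : Finset (Sym2 L.Vertex)) (C : Set L.Vertex) (f : Sym2 L.Vertex → ℝ) (r : ℝ)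
    (h1 : ∀ e ∈ E, r ≤ f e) (h2 : ∀ e ∈ E, (∀ v ∈ e, v ∉ C) → r + 1 / 2 ≤ f e) :
    r * E.card + 1 / 2 * (E.filter fun e => ∀ v ∈ e, v ∉ C).card ≤ ∑ e ∈ E, f e := by
  have : r * E.card + 1 / 2 * (E.filter fun e => ∀ v ∈ e, v ∉ C).card =
      ∑ e ∈ E, (r + 1 / 2 * if ∀ v ∈ e, v ∉ C then 1 else 0) := by
    rw [Finset.sum_add_distrib, Finset.sum_const, nsmul_eq_mul, ← Finset.mul_sum,
      Finset.sum_boole]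
    ring
  rw [this]
  refine Finset.sum_le_sum fun e he => ?_
  split_ifs with hu
  · linarith [h2 e he hu]
  · linarith [h1 e he]

/-- The smallest surplus of an uncovered edge is 2 - √2 ≥ 1/2, for a long edge with z = 1. -/
theorem le_cost (h : L.IsEmbedding Pt E₁ E₂) {S : Finset (EuclideanSpace ℝ (Fin d))}
    (hS : S ⊆ L.candidates Pt) (hne : S.Nonempty) {z : ℕ} (hz : z = 1 ∨ z = 2) :
    E₁.card + √2 ^ z * E₂.card + 1 / 2 * (L.uncovered {v | Pt v ∈ S}).card ≤
      cost z (L.clients Pt) S := by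
  classical
  have hE₁ : ∀ e ∈ E₁, e ∈ L.edges := fun e he => (h.cover e).2 (Or.inl he)
  have hE₂ : ∀ e ∈ E₂, e ∈ L.edges := fun e he => (h.cover e).2 (Or.inr he)
  have h3 := sqrt_two_le
  have hs : √2 ^ 2 = 2 := Real.sq_sqrt (by norm_num)
  have hfar : ∀ e ∈ L.edges, (∀ v ∈ e, v ∉ {v | Pt v ∈ S}) → (2 : ℝ) ^ z ≤
      Metric.infDist (L.edgeMidpoint Pt e) (S : Set (EuclideanSpace ℝ (Fin d))) ^ z :=
    fun e he hu => pow_le_pow_left₀ (by norm_num)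
      (h.le_infDist hS hne he le_rfl fun v hv hvS => absurd hvS (hu v hv)) z
  have h1 := sum_le E₁ {v | Pt v ∈ S} (fun e =>
      Metric.infDist (L.edgeMidpoint Pt e) (S : Set (EuclideanSpace ℝ (Fin d))) ^ z) 1
    (fun e he => one_le_pow₀
      (h.le_infDist hS hne (hE₁ e he) (by norm_num) fun v hv _ => (h.dist_eq_one he hv).ge))
    (fun e he hu => le_trans (by rcases hz with rfl | rfl <;> norm_num) (hfar e (hE₁ e he) hu))
  have h2 := sum_le E₂ {v | Pt v ∈ S} (fun e =>
      Metric.infDist (L.edgeMidpoint Pt e) (S : Set (EuclideanSpace ℝ (Fin d))) ^ z) (√2 ^ z)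
    (fun e he => pow_le_pow_left₀ (Real.sqrt_nonneg 2)
      (h.le_infDist hS hne (hE₂ e he) (by linarith) fun v hv _ => (h.dist_eq_sqrt_two he hv).ge) z)
    (fun e he hu => le_trans (by rcases hz with rfl | rfl <;> norm_num <;> linarith)
      (hfar e (hE₂ e he) hu))
  rw [h.cost_eq, h.card_uncovered]
  push_cast
  linarith

/-- The surplus U/2 is at most ε times the base cost, and the base cost is at most 2|E|. -/
theorem card_uncovered_le (h : L.IsEmbedding Pt E₁ E₂) {S : Finset (EuclideanSpace ℝ (Fin d))}
    (hS : S ⊆ L.candidates Pt) (hne : S.Nonempty) {ε : ℝ} (hε : 0 ≤ ε)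
    (hcost : cost 2 (L.clients Pt) S ≤ (1 + ε) * ((E₁.card : ℝ) + 2 * (E₂.card : ℝ)) ∨
      cost 1 (L.clients Pt) S ≤ (1 + ε) * ((E₁.card : ℝ) + √2 * (E₂.card : ℝ))) :
    ((L.uncovered {v | Pt v ∈ S}).card : ℝ) ≤ 4 * ε * L.edges.card := by
  have h3 := sqrt_two_le
  have hE := h.card_edges
  have h4 : 0 ≤ ε * E₁.card := by positivity
  have h5 : 0 ≤ ε * E₂.card := by positivity
  rw [hE]
  push_cast
  rcases hcost with hc | hc
  · have h1 := h.le_cost hS hne (Or.inr rfl)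
    rw [Real.sq_sqrt (by norm_num : (0 : ℝ) ≤ 2)] at h1
    linarith
  · have h1 := h.le_cost hS hne (Or.inl rfl)
    rw [pow_one] at h1
    nlinarith

theorem sum_ind_eq_card (h : L.IsEmbedding Pt E₁ E₂) {S : Finset (EuclideanSpace ℝ (Fin d))}
    (hS : S ⊆ L.candidates Pt) : ∑ v, L.ind {v | Pt v ∈ S} v = S.card := by
  classical
  have : S = (Finset.univ.filter fun v => Pt v ∈ S).image Pt := by
    ext y
    simp only [Finset.mem_image, Finset.mem_filter, Finset.mem_univ, true_and]
    constructor
    · intro hy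
      obtain ⟨v, -, rfl⟩ := Finset.mem_image.1 (hS hy)
      exact ⟨v, hy, rfl⟩
    · rintro ⟨v, hv, rfl⟩
      exact hv
  conv_rhs => rw [this]
  rw [Finset.card_image_of_injective _ h.injective, Finset.card_filter]
  exact Finset.sum_congr rfl fun v _ => by simp [ind]

end IsEmbedding

/-- Without variables there may be no centers, and then the cost carries no information; but there
are no clauses either. -/
theorem eq_zero_of_no_variables (ψ : CNF33 0 m) : m = 0 := by
  by_contra hm
  have hj := ψ.width ⟨0, Nat.pos_of_ne_zero hm⟩
  cases hc : ψ.clause ⟨0, Nat.pos_of_ne_zero hm⟩ with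
  | nil => rw [hc] at hj; simp at hj
  | cons l _ => exact l.1.elim0

end Layout

end VCClustering

end

/-! ### The main theorem -/

theorem mainTheorem5 :
    ∃ c' : ℝ, 0 < c' ∧
    ∃ (M : Turing.TM2ComputableAux Tok Bool) (time : Polynomial ℕ),
    ∀ (n m d : ℕ) (φ : CNF33 n m) (L : Layout φ) (Pt : L.Vertex → EuclideanSpace ℝ (Fin d))
      (E₁ E₂ : Finset (Sym2 L.Vertex)), L.IsEmbedding Pt E₁ E₂ →
    ∀ (ε : ℝ), 0 ≤ ε →
    ∀ (S : Finset (EuclideanSpace ℝ (Fin d))),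
      IsSolution (L.candidates Pt) L.numCenters S →
      (cost 2 (L.clients Pt) S ≤ (1 + ε) * ((E₁.card : ℝ) + 2 * (E₂.card : ℝ)) ∨
        cost 1 (L.clients Pt) S ≤ (1 + ε) * ((E₁.card : ℝ) + √2 * (E₂.card : ℝ))) →
      ∃ α : Fin n → Bool,
        Outputs M (L.encode {v | Pt v ∈ S}) α (time.eval (Fintype.card L.Vertex)) ∧
        (m : ℝ) - c' * ε * (L.edges.card : ℝ) ≤ (φ.numSatisfied α : ℝ) := by
  -- 144 = 36 · 4: at most 36 lost clauses per uncovered edge, and at most 4ε|E| uncovered edges.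
  -- The polynomial is twice the bound on the input length, plus 2.
  refine ⟨144, by norm_num, Decoder.decoder,
    2 * (6 * Polynomial.X ^ 2 + 91 * Polynomial.X) + 2, ?_⟩
  intro n m d φ L Pt E₁ E₂ h ε hε S hS hcost
  refine ⟨L.assignment {v | Pt v ∈ S}, ?_, ?_⟩
  · refine Decoder.outputs_decode _ _ _ (L.decode_encode _) ?_
    have := L.length_encode_le {v | Pt v ∈ S}
    simp only [Polynomial.eval_add, Polynomial.eval_mul, Polynomial.eval_pow, Polynomial.eval_X,
      Polynomial.eval_ofNat]
    omega
  · rcases Nat.eq_zero_or_pos n with rfl | hn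
    · obtain rfl := Layout.eq_zero_of_no_variables φ
      have h1 : 0 ≤ 144 * ε * (L.edges.card : ℝ) := by positivity
      have h2 : (0 : ℝ) ≤ (φ.numSatisfied (L.assignment {v | Pt v ∈ S}) : ℝ) := Nat.cast_nonneg _
      push_cast
      linarith
    · have hne : S.Nonempty := by
        rw [← Finset.card_pos, hS.2]
        unfold Layout.numCenters
        omega
      have h1 := h.card_uncovered_le hS.1 hne hε hcost
      have h2 := Layout.le_numSatisfied_add {v | Pt v ∈ S}
        ((h.sum_ind_eq_card hS.1).trans hS.2).le
      have h3 : (m : ℝ) ≤ φ.numSatisfied (L.assignment {v | Pt v ∈ S}) +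
          36 * (L.uncovered {v | Pt v ∈ S}).card := by exact_mod_cast h2
      linarith
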